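/- Let $1\le m<d$ be integers. There is a constant $a>0$ depending only on $d$ and $m$, and for every $\delta>0$ a constant $C>0$ depending only on $d$, $m$ and $\delta$, such that the following holds for every integer $K\ge 1$. Let $W_1,\dots,W_K\in\mathbb{R}^{d\times m}$ be independent random matrices whose entries are i.i.d. centered Gaussians with common variance $v>0$. Then with probability at least $1-\delta e^{-aK}$ (that is, outside an event of outer probability at most $\delta e^{-aK}$) the following is true simultaneously for all $B>0$, all $L_R\ge 0$ and all pairs of probability densities $\mathbb{P}_x,\mathbb{P}_g:\mathbb{R}^d\to[0,\infty)$ (with respect to Lebesgue measure) that vanish outside a common closed Euclidean ball of radius $B$: if for every $k\in\{1,\dots,K\}$ the marginals along $W_k$ agree, i.e. the law of $W_k^T x$ for $x$ with density $\mathbb{P}_x$ equals the law of $W_k^T y$ for $y$ with density $\mathbb{P}_g$, and if the residual $R=\mathbb{P}_x-\mathbb{P}_g$ is $L_R$-Lipschitz for the Euclidean distance, then $$|R(x)|=|\mathbb{P}_x(x)-\mathbb{P}_g(x)|\;\le\; C\,\frac{B\,L_R}{K^{1/(d-m)}}\qquad\text{for every } x\in\mathbb{R}^d .$$ -/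

import Mathlib

open MeasureTheory ProbabilityTheory
open scoped NNReal ENNReal Matrix

namespace RandomProjections

/-- A probability density on `ℝ^d`: a nonnegative integrable function with total integral one. -/
structure IsDensity {d : ℕ} (p : EuclideanSpace ℝ (Fin d) → ℝ) : Prop where
  nonneg : ∀ x, 0 ≤ p x
  integrable : Integrable p volume
  integral_eq_one : ∫ x, p x = 1

/-- The distribution on `ℝ^d` with density `p` with respect to Lebesgue measure. -/
noncomputable def distribution {d : ℕ} (p : EuclideanSpace ℝ (Fin d) → ℝ) :
    Measure (EuclideanSpace ℝ (Fin d)) :=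
  volume.withDensity (fun x => ENNReal.ofReal (p x))

/-- The marginal along `W` of the distribution with density `p`: the law of `Wᵀ x` in `ℝ^m` when
`x` has density `p`. -/
noncomputable def marginal {d m : ℕ} (W : Matrix (Fin d) (Fin m) ℝ)
    (p : EuclideanSpace ℝ (Fin d) → ℝ) : Measure (Fin m → ℝ) :=
  (distribution p).map (fun x => Wᵀ *ᵥ x.ofLp)

/-- `W 0, …, W (K - 1)` are independent random `d × m` matrices whose entries are independent
centered Gaussian variables of variance `v`. -/
structure IsGaussianProjections {Ω : Type*} [MeasurableSpace Ω] (P : Measure Ω) {d m K : ℕ}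
    (v : ℝ≥0) (W : Fin K → Ω → Matrix (Fin d) (Fin m) ℝ) : Prop where
  entry_law : ∀ k i j, HasLaw (fun ω => W k ω i j) (gaussianReal 0 v) P
  indep : iIndepFun (fun (t : Fin K × Fin d × Fin m) (ω : Ω) => W t.1 ω t.2.1 t.2.2) P

/-- With the constant `C`, the residual bound holds for the projections `W`: for all densities
`p`, `q` supported in a common closed ball of radius `B` whose marginals along every `W k` agree and
whose residual `p - q` is `L`-Lipschitz, `|p x - q x| ≤ C * (B * L / K ^ (1 / (d - m)))` for
every `x`. -/
def ResidualBound {d m K : ℕ} (W : Fin K → Matrix (Fin d) (Fin m) ℝ) (C : ℝ) : Prop :=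
  ∀ (p q : EuclideanSpace ℝ (Fin d) → ℝ) (x₀ : EuclideanSpace ℝ (Fin d)) (B : ℝ) (L : ℝ≥0),
    0 < B → IsDensity p → IsDensity q →
    Function.support p ⊆ Metric.closedBall x₀ B →
    Function.support q ⊆ Metric.closedBall x₀ B →
    (∀ k, marginal (W k) p = marginal (W k) q) →
    LipschitzWith L (fun x => p x - q x) →
    ∀ x, |p x - q x| ≤ C * (B * (L : ℝ) / (K : ℝ) ^ ((1 : ℝ) / ((d : ℝ) - (m : ℝ))))

end RandomProjections

/-!
The bound holds almost surely. Let `R = p - q`. Equality of the marginals along `W k` says that for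
every `j` the form `w ↦ ∫ ⟪w, x⟫ ^ j R(x) dx` vanishes on the range of `W k`, and the coefficients
of this form are, up to multinomial factors, the moments of `R` of order `j`.

*Generic unisolvence.* If `K ≥ (n + 1) ^ (d - m)`, then almost surely a form of degree at most `n`
that vanishes on the ranges of all `K` matrices is zero (`ae_determinesForms`). This is true for one
configuration: the graphs `{(u, t u₀)}` with `t` in the grid `{0, …, n} ^ (d - m)`, because a
polynomial of degree at most `n` in each variable that vanishes on the grid is zero
(`eq_zero_of_eval_graphMatrix`). Unisolvence at one configuration gives a minor that is a nonzero
polynomial in the entries, and the zero set of such a polynomial is null for the law of the entries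
(`ae_eval_ne_zero_pi`).

*Jackson's theorem.* Hence `R` is almost surely orthogonal to all polynomials of degree at most `n`,
with `n` of order `K ^ (1 / (d - m))`, for all admissible `p` and `q` at once
(`integral_eval_mul_eq_zero`). The polynomial kernel
`(sin ((2 k + 1) θ) / sin θ) ^ (2 (d + 1))`, with `sin θ = ‖y - x‖ / (2 B)`, is nonnegative and
concentrated around `x` at scale `B / k`. Orthogonality to it expresses `R x` as a kernel average of
`R x - R y`, which the Lipschitz bound makes at most a multiple of `B L / k`
(`abs_sub_le_of_determinesForms`). With `k` proportional to `K ^ (1 / (d - m))` this is the claim.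
-/

namespace RandomProjections

/-! ### Zero sets of polynomials under product measures -/

/-- The zero set of a nonzero polynomial is null for a power of an atomless probability measure:
off the null set where the leading coefficient in the first variable vanishes, the slices of the
zero set are finite. -/
theorem ae_eval_ne_zero_pi_fin (μ : Measure ℝ) [IsProbabilityMeasure μ] [NullSingletonClass μ] :
    ∀ (n : ℕ) (p : MvPolynomial (Fin n) ℝ), p ≠ 0 →
      ∀ᵐ x ∂Measure.pi (fun _ : Fin n => μ), MvPolynomial.eval x p ≠ 0 := by
  intro n
  induction n with
  | zero =>
    intro p hp
    refine Filter.Eventually.of_forall fun x hx => hp ?_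
    refine MvPolynomial.funext fun y => ?_
    rw [Subsingleton.elim y x, hx, map_zero]
  | succ n ih =>
    intro p hp
    have hq : MvPolynomial.finSuccEquiv ℝ n p ≠ 0 := by
      simpa using hp
    have hlead := ih _ (Polynomial.leadingCoeff_ne_zero.2 hq)
    have hmp := measurePreserving_piFinSuccAbove (fun _ : Fin (n + 1) => μ) 0
    have key : ∀ᵐ z ∂(μ.prod (Measure.pi fun _ : Fin n => μ)),
        MvPolynomial.eval (Fin.cons z.1 z.2 : Fin (n + 1) → ℝ) p ≠ 0 := by
      have hmeas : MeasurableSet {z : ℝ × (Fin n → ℝ) |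
          MvPolynomial.eval (Fin.cons z.1 z.2 : Fin (n + 1) → ℝ) p ≠ 0} := by
        have : Continuous fun z : ℝ × (Fin n → ℝ) =>
            MvPolynomial.eval (Fin.cons z.1 z.2 : Fin (n + 1) → ℝ) p :=
          (MvPolynomial.continuous_eval p).comp (by fun_prop)
        exact (isOpen_ne.preimage this).measurableSet
      rw [← Measure.prod_swap, ae_map_iff (by fun_prop) hmeas]
      refine (Measure.ae_prod_iff_ae_ae (measurable_swap hmeas)).2 ?_
      filter_upwards [hlead] with y hy
      have hne : Polynomial.map (MvPolynomial.eval y) (MvPolynomial.finSuccEquiv ℝ n p) ≠ 0 := by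
        intro h
        apply hy
        have := congrArg (fun r => r.coeff (MvPolynomial.finSuccEquiv ℝ n p).natDegree) h
        simpa [Polynomial.coeff_map] using this
      have hfin : (((Polynomial.map (MvPolynomial.eval y)
          (MvPolynomial.finSuccEquiv ℝ n p)).roots.toFinset : Set ℝ)).Finite :=
        Finset.finite_toSet _
      filter_upwards [compl_mem_ae_iff.2 (hfin.measure_zero μ)] with t ht
      simpa [MvPolynomial.eval_eq_eval_mv_eval', hne] using ht
    have := hmp.quasiMeasurePreserving.ae key
    filter_upwards [this] with x hx
    convert hx using 3
    exact (Fin.cons_self_tail x).symm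

theorem ae_eval_ne_zero_pi {σ : Type*} [Fintype σ] (μ : Measure ℝ) [IsProbabilityMeasure μ]
    [NullSingletonClass μ] (p : MvPolynomial σ ℝ) (hp : p ≠ 0) :
    ∀ᵐ x ∂Measure.pi (fun _ : σ => μ), MvPolynomial.eval x p ≠ 0 := by
  let e := Fintype.equivFin σ
  have h := ae_eval_ne_zero_pi_fin μ _ (MvPolynomial.rename e p)
    (by simpa using (MvPolynomial.rename_injective e e.injective).ne hp)
  have hmp := measurePreserving_piCongrLeft (fun _ : Fin (Fintype.card σ) => μ) e
  filter_upwards [hmp.quasiMeasurePreserving.ae h] with x hx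
  rw [MvPolynomial.eval_rename] at hx
  convert hx using 3
  ext i
  simp [MeasurableEquiv.coe_piCongrLeft]

/-! ### Generic unisolvence -/

/-- If the linear system `∑ a, c a * φ i a = 0`, whose coefficients are polynomials in a parameter,
has only the zero solution at one parameter `x₀`, then it has only the zero solution off the zero
set of a nonzero polynomial, namely a maximal minor that does not vanish at `x₀`. -/
theorem exists_ne_zero_of_eval_injective {A ι τ : Type*} [Fintype A] (φ : ι → A → MvPolynomial τ ℝ)
    (x₀ : τ → ℝ)
    (h : ∀ c : A → ℝ, (∀ i, ∑ a, c a * MvPolynomial.eval x₀ (φ i a) = 0) → c = 0) :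
    ∃ D : MvPolynomial τ ℝ, D ≠ 0 ∧ ∀ x, MvPolynomial.eval x D ≠ 0 →
      ∀ c : A → ℝ, (∀ i, ∑ a, c a * MvPolynomial.eval x (φ i a) = 0) → c = 0 := by
  classical
  -- The rows at `x₀` span, so finitely many of them, indexed by `A`, form a basis.
  let v : ι → A → ℝ := fun i a => MvPolynomial.eval x₀ (φ i a)
  have hspan : Submodule.span ℝ (Set.range v) = ⊤ := by
    by_contra hne
    obtain ⟨f, hf0, hf⟩ := Submodule.exists_le_ker_of_lt_top _ (lt_top_iff_ne_top.2 hne)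
    apply hf0
    have hrep : ∀ w : A → ℝ, f w = ∑ a, f (Pi.single a 1) * w a := by
      intro w
      conv_lhs => rw [pi_eq_sum_univ' w]
      simp [map_sum, mul_comm, Pi.single]
    have hc := h (fun a => f (Pi.single a 1)) (fun i => by
      rw [← hrep (v i)]
      exact hf (Submodule.subset_span ⟨i, rfl⟩))
    ext a
    simpa using congrFun hc a
  obtain ⟨g, hg, -, hli⟩ := Submodule.exists_fun_fin_finrank_span_eq ℝ (Set.range v)
  have hcard : Module.finrank ℝ (Submodule.span ℝ (Set.range v)) = Fintype.card A := by
    rw [hspan]; simp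
  let e : A ≃ Fin (Module.finrank ℝ (Submodule.span ℝ (Set.range v))) :=
    (Fintype.equivFin A).trans (finCongr hcard.symm)
  choose s hs using fun a => hg (e a)
  let M : Matrix A A (MvPolynomial τ ℝ) := Matrix.of fun a b => φ (s a) b
  have hM : ∀ x, MvPolynomial.eval x M.det =
      (Matrix.of fun a b => MvPolynomial.eval x (φ (s a) b)).det := by
    intro x
    rw [RingHom.map_det]
    rfl
  refine ⟨M.det, fun h0 => ?_, fun x hx c hc => ?_⟩
  · have hli' : LinearIndependent ℝ (Matrix.of fun a b => MvPolynomial.eval x₀ (φ (s a) b)).row := by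
      have hrow : (Matrix.of fun a b => MvPolynomial.eval x₀ (φ (s a) b)).row = g ∘ e := by
        ext a b
        exact congrFun (hs a) b
      rw [hrow]
      exact hli.comp e e.injective
    have hu := (Matrix.isUnit_iff_isUnit_det _).1 (Matrix.linearIndependent_rows_iff_isUnit.1 hli')
    rw [← hM, h0, map_zero] at hu
    exact not_isUnit_zero hu
  · rw [hM] at hx
    refine Matrix.eq_zero_of_mulVec_eq_zero hx ?_
    ext a
    simpa [Matrix.mulVec, dotProduct, mul_comm] using hc (s a)

/-- Every form of degree at most `n` on `ℝ^d` that vanishes on the range of each `W k` is zero.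
The form of degree `j` with coefficients `c` is encoded by its values
`∑ a, c a * ∏ i, w i ^ a i`, summed over the exponents `a` with `∑ i, a i = j`. -/
def DeterminesForms {d m K : ℕ} (W : Fin K → Matrix (Fin d) (Fin m) ℝ) (n : ℕ) : Prop :=
  ∀ j ≤ n, ∀ c : (Fin d → ℕ) → ℝ,
    (∀ k u, ∑ a ∈ Finset.univ.piAntidiag j, c a * ∏ i, (W k *ᵥ u) i ^ a i = 0) →
    ∀ a ∈ Finset.univ.piAntidiag j, c a = 0

/-- The matrix whose range is `{(u, t u₀)}`, the graph over the first `m` coordinates of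
`u ↦ u₀ • t`. -/
def graphMatrix {d m : ℕ} (t : Fin (d - m) → ℝ) : Matrix (Fin d) (Fin m) ℝ := fun i j =>
  if h : i.1 < m then if i.1 = j.1 then 1 else 0
  else if j.1 = 0 then t ⟨i.1 - m, by omega⟩ else 0

theorem graphMatrix_mulVec {d m : ℕ} (hm : 1 ≤ m) (t : Fin (d - m) → ℝ) (u : Fin m → ℝ)
    (i : Fin d) :
    (graphMatrix t *ᵥ u) i =
      if h : i.1 < m then u ⟨i.1, h⟩ else t ⟨i.1 - m, by omega⟩ * u ⟨0, hm⟩ := by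
  simp only [Matrix.mulVec, dotProduct, graphMatrix]
  by_cases h : i.1 < m
  · rw [Finset.sum_eq_single ⟨i.1, h⟩]
    · simp only [h, dif_pos, if_true, one_mul]
    · intro j _ hj
      have hij : i.1 ≠ j.1 := fun hh => hj (Fin.ext hh.symm)
      simp [h, hij]
    · simp
  · rw [Finset.sum_eq_single ⟨0, hm⟩]
    · simp only [h, dif_neg, if_true, not_false_eq_true]
    · intro j _ hj
      have hij : j.1 ≠ 0 := fun hh => hj (Fin.ext hh)
      simp only [h, dif_neg, not_false_eq_true, if_neg hij, zero_mul]
    · simp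

theorem totalDegree_aeval_le {σ τ : Type*} [Fintype σ] (g : σ → MvPolynomial τ ℝ)
    (hg : ∀ i, (g i).totalDegree ≤ 1) (p : MvPolynomial σ ℝ) :
    (MvPolynomial.aeval g p).totalDegree ≤ p.totalDegree := by
  rw [MvPolynomial.aeval_def, MvPolynomial.eval₂_eq]
  refine MvPolynomial.totalDegree_finsetSum_le fun s hs => ?_
  refine (MvPolynomial.totalDegree_mul _ _).trans ?_
  have h1 : (algebraMap ℝ (MvPolynomial τ ℝ) (p.coeff s)).totalDegree = 0 :=
    MvPolynomial.totalDegree_C _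
  rw [h1, zero_add]
  refine (MvPolynomial.totalDegree_finsetProd _ _).trans ?_
  refine le_trans (Finset.sum_le_sum fun i _ => ?_) (MvPolynomial.le_totalDegree hs)
  refine (MvPolynomial.totalDegree_pow _ _).trans ?_
  simpa using Nat.mul_le_mul_left (s i) (hg i)

/-- The `(n + 1) ^ (d - m)` graphs with slope `t ∈ {0, …, n} ^ (d - m)` determine polynomials of
degree at most `n`: for fixed `x` with `x₀ ≠ 0`, restricting the last `d - m` coordinates of `p` to
`t x₀` gives a polynomial in `t` of degree at most `n` that vanishes on the grid. -/
theorem eq_zero_of_eval_graphMatrix {d m n : ℕ} (hm : 1 ≤ m) (hmd : m < d)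
    (p : MvPolynomial (Fin d) ℝ) (hp : p.totalDegree ≤ n)
    (h : ∀ (t : Fin (d - m) → Fin (n + 1)) (u : Fin m → ℝ),
      MvPolynomial.eval (graphMatrix (fun i => ((t i : ℕ) : ℝ)) *ᵥ u) p = 0) : p = 0 := by
  classical
  let o : Fin d := ⟨0, by omega⟩
  have hx : ∀ x : Fin d → ℝ, x o ≠ 0 → MvPolynomial.eval x p = 0 := by
    intro x hxo
    let g : Fin d → MvPolynomial (Fin (d - m)) ℝ := fun i =>
      if h : i.1 < m then MvPolynomial.C (x i)
      else MvPolynomial.C (x o) * MvPolynomial.X ⟨i.1 - m, by omega⟩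
    have hg : ∀ i, (g i).totalDegree ≤ 1 := by
      intro i
      simp only [g]
      split_ifs
      · simp
      · refine (MvPolynomial.totalDegree_mul _ _).trans ?_
        simp
    have hev : ∀ t, MvPolynomial.eval t (MvPolynomial.aeval g p) = MvPolynomial.eval
        (graphMatrix t *ᵥ fun j : Fin m => x ⟨j.1, by omega⟩) p := by
      intro t
      rw [← MvPolynomial.coe_aeval_eq_eval, ← MvPolynomial.coe_aeval_eq_eval]
      simp only [RingHom.coe_coe]
      rw [← AlgHom.comp_apply]
      congr 1
      ext i
      rw [AlgHom.comp_apply, MvPolynomial.aeval_X, MvPolynomial.aeval_X, graphMatrix_mulVec hm]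
      simp only [g]
      split_ifs
      · simp
      · simp [o, mul_comm]
    have hzero : MvPolynomial.aeval g p = 0 := by
      refine MvPolynomial.eq_zero_of_eval_zero_at_prod_finset _
        (fun _ => (Finset.range (n + 1)).image (fun k : ℕ => (k : ℝ))) (fun i => ?_) fun t ht => ?_
      · rw [Finset.card_image_of_injective _ Nat.cast_injective, Finset.card_range]
        exact Nat.lt_succ_of_le (((MvPolynomial.degreeOf_le_totalDegree _ i).trans
          (totalDegree_aeval_le g hg p)).trans hp)
      · have ht' : ∀ i, ∃ k : Fin (n + 1), ((k : ℕ) : ℝ) = t i := by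
          intro i
          obtain ⟨k, hk, hkt⟩ := Finset.mem_image.1 (ht i)
          exact ⟨⟨k, Finset.mem_range.1 hk⟩, hkt⟩
        choose k hk using ht'
        rw [hev, ← funext hk]
        exact h k _
    have := hev (fun i => x ⟨i.1 + m, by omega⟩ / x o)
    rw [hzero, map_zero] at this
    rw [this]
    congr 2
    ext i
    rw [graphMatrix_mulVec hm]
    split_ifs with hi
    · rfl
    · have : (⟨i.1 - m + m, by omega⟩ : Fin d) = i := Fin.ext (by simp; omega)
      simp only [this]
      exact (div_mul_cancel₀ _ hxo).symm
  -- The points with `x₀ = 0` are absorbed by the factor `X₀`.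
  have hmul : MvPolynomial.X o * p = 0 := by
    refine MvPolynomial.funext fun x => ?_
    by_cases hxo : x o = 0
    · simp [hxo]
    · simp [hx x hxo]
  exact (mul_eq_zero.1 hmul).resolve_left (MvPolynomial.X_ne_zero _)

theorem determinesForms_graphMatrix {d m n K : ℕ} (hm : 1 ≤ m) (hmd : m < d)
    (hK : (n + 1) ^ (d - m) ≤ K) :
    ∃ W : Fin K → Matrix (Fin d) (Fin m) ℝ, DeterminesForms W n := by
  classical
  obtain ⟨f⟩ : Nonempty ((Fin (d - m) → Fin (n + 1)) ↪ Fin K) :=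
    Function.Embedding.nonempty_of_card_le (by simpa using hK)
  refine ⟨fun k => graphMatrix fun i => ((Function.invFun f k i : ℕ) : ℝ), fun j hj c hc a ha => ?_⟩
  let p : MvPolynomial (Fin d) ℝ := ∑ b ∈ Finset.univ.piAntidiag j,
    MvPolynomial.monomial (Finsupp.equivFunOnFinite.symm b) (c b)
  have hp0 : p = 0 := by
    refine eq_zero_of_eval_graphMatrix (n := n) hm hmd p ?_ fun t u => ?_
    · refine MvPolynomial.totalDegree_finsetSum_le fun b hb => ?_
      refine (MvPolynomial.totalDegree_monomial_le _ _).trans (le_trans (le_of_eq ?_) hj)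
      rw [Finsupp.sum_fintype _ _ (by simp)]
      simpa using (Finset.mem_piAntidiag.1 hb).1
    · have := hc (f t) u
      simp only [Function.leftInverse_invFun f.injective t] at this
      rw [← this]
      simp [p, MvPolynomial.eval_monomial, Finsupp.prod_fintype]
  have hcoeff := congrArg (MvPolynomial.coeff (Finsupp.equivFunOnFinite.symm a)) hp0
  simpa [p, MvPolynomial.coeff_sum, MvPolynomial.coeff_monomial, ha] using hcoeff

/-- Unisolvence is generic: it holds for one configuration, hence off the zero set of a nonzero
polynomial in the entries, which is null for an atomless product measure. -/
theorem ae_determinesForms {d m n K : ℕ} (hm : 1 ≤ m) (hmd : m < d)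
    (hK : (n + 1) ^ (d - m) ≤ K) (μ : Measure ℝ) [IsProbabilityMeasure μ]
    [NullSingletonClass μ] :
    ∀ᵐ x ∂Measure.pi (fun _ : Fin K × Fin d × Fin m => μ),
      DeterminesForms (fun k i j => x (k, i, j)) n := by
  classical
  obtain ⟨W, hW⟩ := determinesForms_graphMatrix hm hmd hK
  simp only [DeterminesForms]
  refine ae_all_iff.2 fun j => ?_
  by_cases hj : j ≤ n
  swap
  · exact Filter.Eventually.of_forall fun x h => absurd h hj
  let φ : Fin K × (Fin m → ℝ) → ↥(Finset.univ.piAntidiag j : Finset (Fin d → ℕ)) →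
      MvPolynomial (Fin K × Fin d × Fin m) ℝ := fun s a =>
    ∏ i, (∑ l, MvPolynomial.X (s.1, i, l) * MvPolynomial.C (s.2 l)) ^ (a.1 i)
  have hφ : ∀ (x : Fin K × Fin d × Fin m → ℝ) s a, MvPolynomial.eval x (φ s a) =
      ∏ i, ((Matrix.of fun i l => x (s.1, i, l)) *ᵥ s.2) i ^ (a.1 i) := by
    intro x s a
    simp [φ, Matrix.mulVec, dotProduct]
  obtain ⟨D, hD0, hD⟩ := exists_ne_zero_of_eval_injective φ (fun z => W z.1 z.2.1 z.2.2) (by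
    intro c hc
    have := hW j hj (fun a => if h : a ∈ Finset.univ.piAntidiag j then c ⟨a, h⟩ else 0) (by
      intro k u
      rw [← hc (k, u), ← Finset.sum_coe_sort]
      refine Finset.sum_congr rfl fun a _ => ?_
      rw [hφ, dif_pos a.2]
      rfl)
    ext a
    simpa using this a.1 a.2)
  filter_upwards [ae_eval_ne_zero_pi μ D hD0] with x hx _ c hc a ha
  have := hD x hx (fun a => c a.1) (by
    rintro ⟨k, u⟩
    rw [← hc k u, ← Finset.sum_coe_sort (Finset.univ.piAntidiag j)]
    refine Finset.sum_congr rfl fun a _ => ?_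
    rw [hφ]
    rfl)
  exact congrFun this ⟨a, ha⟩

theorem IsGaussianProjections.ae_determinesForms {Ω : Type*} [MeasurableSpace Ω] {P : Measure Ω}
    [IsProbabilityMeasure P] {d m n K : ℕ} {v : ℝ≥0} {W : Fin K → Ω → Matrix (Fin d) (Fin m) ℝ}
    (hv : v ≠ 0) (hW : IsGaussianProjections P v W) (hm : 1 ≤ m) (hmd : m < d)
    (hK : (n + 1) ^ (d - m) ≤ K) :
    ∀ᵐ ω ∂P, DeterminesForms (fun k => W k ω) n := by
  have : NullSingletonClass (gaussianReal 0 v) :=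
    ⟨fun x => gaussianReal_absolutelyContinuous 0 hv (measure_singleton x)⟩
  have hmeas : ∀ t : Fin K × Fin d × Fin m, AEMeasurable (fun ω => W t.1 ω t.2.1 t.2.2) P :=
    fun t => (hW.entry_law t.1 t.2.1 t.2.2).aemeasurable
  have hmap := (iIndepFun_iff_map_fun_eq_pi_map hmeas).1 hW.indep
  simp only [fun t : Fin K × Fin d × Fin m => (hW.entry_law t.1 t.2.1 t.2.2).map_eq] at hmap
  have h := RandomProjections.ae_determinesForms (n := n) hm hmd hK (gaussianReal 0 v)
  rw [← hmap] at h
  exact ae_of_ae_map (aemeasurable_pi_lambda _ hmeas) h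

/-! ### Vanishing moments of the residual -/

theorem IsDensity.integral_marginal {d m : ℕ} {p : EuclideanSpace ℝ (Fin d) → ℝ}
    (hp : IsDensity p) (W : Matrix (Fin d) (Fin m) ℝ) {f : (Fin m → ℝ) → ℝ} (hf : Continuous f) :
    ∫ y, f y ∂marginal W p = ∫ x, f (Wᵀ *ᵥ x.ofLp) * p x := by
  have hc : Continuous fun x : EuclideanSpace ℝ (Fin d) => Wᵀ *ᵥ x.ofLp :=
    Continuous.matrix_mulVec continuous_const (by fun_prop)
  rw [marginal, integral_map hc.aemeasurable hf.aestronglyMeasurable, distribution,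
    integral_withDensity_eq_integral_toReal_smul₀ hp.integrable.aemeasurable.ennreal_ofReal
      (Filter.Eventually.of_forall fun _ => ENNReal.ofReal_lt_top)]
  refine integral_congr_ae (Filter.Eventually.of_forall fun x => ?_)
  simp [ENNReal.toReal_ofReal (hp.nonneg x), mul_comm]

theorem IsDensity.integrable_continuous_mul {d : ℕ} {p : EuclideanSpace ℝ (Fin d) → ℝ}
    (hp : IsDensity p) {x₀ : EuclideanSpace ℝ (Fin d)} {B : ℝ}
    (hs : Function.support p ⊆ Metric.closedBall x₀ B)
    {g : EuclideanSpace ℝ (Fin d) → ℝ} (hg : Continuous g) :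
    Integrable (fun x => g x * p x) := by
  have h := IntegrableOn.continuousOn_mul hg.continuousOn
    (hp.integrable.integrableOn (s := Metric.closedBall x₀ B)) (isCompact_closedBall x₀ B)
  refine (integrableOn_iff_integrable_of_support_subset ?_).1 h
  exact (Function.support_mul_subset_right _ _).trans hs

section Moments

variable {d m K n : ℕ} {W : Fin K → Matrix (Fin d) (Fin m) ℝ}
  {p q : EuclideanSpace ℝ (Fin d) → ℝ} {x₀ : EuclideanSpace ℝ (Fin d)} {B : ℝ}

/-- The `j`-th moment `w ↦ ∫ ⟪w, x⟫ ^ j (p - q)` is a form of degree `j` in `w` whose coefficients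
are, up to multinomial factors, the moments of `p - q`; equality of the marginals along `W k` makes
it vanish on the range of `W k`. -/
theorem integral_prod_pow_eq_zero (hW : DeterminesForms W n) (hp : IsDensity p) (hq : IsDensity q)
    (hsp : Function.support p ⊆ Metric.closedBall x₀ B)
    (hsq : Function.support q ⊆ Metric.closedBall x₀ B)
    (hmarg : ∀ k, marginal (W k) p = marginal (W k) q) (a : Fin d → ℕ) (ha : ∑ i, a i ≤ n) :
    ∫ x, (∏ i, x i ^ a i) * (p x - q x) = 0 := by
  classical
  have hint : ∀ g : EuclideanSpace ℝ (Fin d) → ℝ, Continuous g →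
      Integrable (fun x => g x * (p x - q x)) := by
    intro g hg
    simp only [mul_sub]
    exact (hp.integrable_continuous_mul hsp hg).sub (hq.integrable_continuous_mul hsq hg)
  have hcoeff := hW (∑ i, a i) ha
    (fun b => Nat.multinomial Finset.univ b * ∫ x, (∏ i, x i ^ b i) * (p x - q x)) (by
      intro k u
      have hzero : ∫ x, (∑ i, (W k *ᵥ u) i * x i) ^ (∑ i, a i) * (p x - q x) = 0 := by
        have hcont : Continuous fun y : Fin m → ℝ => (y ⬝ᵥ u) ^ (∑ i, a i) := by
          unfold dotProduct; fun_prop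
        have hdot : ∀ x : EuclideanSpace ℝ (Fin d),
            ((W k)ᵀ *ᵥ x.ofLp) ⬝ᵥ u = ∑ i, (W k *ᵥ u) i * x i := by
          intro x
          rw [Matrix.mulVec_transpose, ← Matrix.dotProduct_mulVec, dotProduct_comm]
          rfl
        have h1 := hp.integral_marginal (W k) hcont
        have h2 := hq.integral_marginal (W k) hcont
        rw [hmarg k, h2] at h1
        simp only [hdot] at h1
        simp only [mul_sub]
        rw [integral_sub (hp.integrable_continuous_mul hsp (by fun_prop))
          (hq.integrable_continuous_mul hsq (by fun_prop)), h1, sub_self]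
      rw [← hzero]
      simp only [Finset.sum_pow_eq_sum_piAntidiag, Finset.sum_mul]
      rw [integral_finsetSum _ fun b _ => hint _ (by fun_prop)]
      refine Finset.sum_congr rfl fun b _ => ?_
      rw [mul_right_comm, ← integral_const_mul]
      refine integral_congr_ae (Filter.Eventually.of_forall fun x => ?_)
      simp only [mul_pow, Finset.prod_mul_distrib]
      ring) a (Finset.mem_piAntidiag.2 ⟨rfl, fun i _ => Finset.mem_univ i⟩)
  exact (mul_eq_zero.1 hcoeff).resolve_left
    (Nat.cast_ne_zero.2 (Nat.multinomial_pos Finset.univ a).ne')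

/-- The residual is orthogonal to all polynomials of degree at most `n`. -/
theorem integral_eval_mul_eq_zero (hW : DeterminesForms W n) (hp : IsDensity p) (hq : IsDensity q)
    (hsp : Function.support p ⊆ Metric.closedBall x₀ B)
    (hsq : Function.support q ⊆ Metric.closedBall x₀ B)
    (hmarg : ∀ k, marginal (W k) p = marginal (W k) q) (f : MvPolynomial (Fin d) ℝ)
    (hf : f.totalDegree ≤ n) :
    ∫ x : EuclideanSpace ℝ (Fin d), MvPolynomial.eval x.ofLp f * (p x - q x) = 0 := by
  classical
  have hint : ∀ g : EuclideanSpace ℝ (Fin d) → ℝ, Continuous g →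
      Integrable (fun x => g x * (p x - q x)) := by
    intro g hg
    simp only [mul_sub]
    exact (hp.integrable_continuous_mul hsp hg).sub (hq.integrable_continuous_mul hsq hg)
  simp only [MvPolynomial.eval_eq', Finset.sum_mul]
  rw [integral_finsetSum _ fun s _ => hint _ (by fun_prop)]
  refine Finset.sum_eq_zero fun s hs => ?_
  simp only [mul_assoc]
  rw [integral_const_mul, integral_prod_pow_eq_zero hW hp hq hsp hsq hmarg s, mul_zero]
  refine le_trans (le_of_eq ?_) ((MvPolynomial.le_totalDegree hs).trans hf)
  rw [Finsupp.sum_fintype _ _ (by simp)]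

end Moments

/-! ### The Jackson kernel -/

/-- The polynomial `S` with `S (sin θ ^ 2) = sin ((2 k + 1) θ) / sin θ`; that is,
`S (1 - X ^ 2) = U (2 k)` for the Chebyshev polynomial `U (2 k)` of the second kind. -/
noncomputable def dirichletPoly : ℕ → Polynomial ℝ
  | 0 => 1
  | 1 => 3 - 4 * Polynomial.X
  | k + 2 => 2 * (1 - 2 * Polynomial.X) * dirichletPoly (k + 1) - dirichletPoly k

theorem natDegree_dirichletPoly_le : ∀ k, (dirichletPoly k).natDegree ≤ k
  | 0 => by simp [dirichletPoly]
  | 1 => by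
    rw [dirichletPoly]
    compute_degree
  | k + 2 => by
    have h1 := natDegree_dirichletPoly_le (k + 1)
    have h0 := natDegree_dirichletPoly_le k
    rw [dirichletPoly]
    refine (Polynomial.natDegree_sub_le _ _).trans (max_le ?_ (by omega))
    refine Polynomial.natDegree_mul_le.trans ?_
    have : (2 * (1 - 2 * Polynomial.X) : Polynomial ℝ).natDegree ≤ 1 := by compute_degree
    omega

theorem sin_mul_eval_dirichletPoly (θ : ℝ) :
    ∀ k : ℕ, Real.sin θ * (dirichletPoly k).eval (Real.sin θ ^ 2) = Real.sin ((2 * k + 1) * θ)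
  | 0 => by simp [dirichletPoly]
  | 1 => by
    have : (2 * ((1 : ℕ) : ℝ) + 1) * θ = 3 * θ := by push_cast; ring
    rw [this, Real.sin_three_mul]
    simp [dirichletPoly]
    ring
  | k + 2 => by
    have h1 := sin_mul_eval_dirichletPoly θ (k + 1)
    have h0 := sin_mul_eval_dirichletPoly θ k
    have e2 : (2 * ((k + 2 : ℕ) : ℝ) + 1) * θ = (2 * ((k + 1 : ℕ) : ℝ) + 1) * θ + 2 * θ := by
      push_cast; ring
    have e0 : (2 * (k : ℝ) + 1) * θ = (2 * ((k + 1 : ℕ) : ℝ) + 1) * θ - 2 * θ := by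
      push_cast; ring
    rw [e0, Real.sin_sub] at h0
    rw [e2, Real.sin_add]
    simp only [dirichletPoly, Polynomial.eval_sub, Polynomial.eval_mul, Polynomial.eval_ofNat,
      Polynomial.eval_one, Polynomial.eval_X]
    have hc : Real.cos (2 * θ) = 1 - 2 * Real.sin θ ^ 2 := by
      rw [Real.cos_two_mul, Real.cos_sq']; ring
    rw [hc] at h0 ⊢
    linear_combination (2 * (1 - 2 * Real.sin θ ^ 2)) * h1 - h0

theorem abs_sin_nat_mul_le (θ : ℝ) (n : ℕ) : |Real.sin (n * θ)| ≤ n * |Real.sin θ| := by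
  induction n with
  | zero => simp
  | succ n ih =>
    push_cast
    rw [add_mul, one_mul, Real.sin_add]
    calc |Real.sin (n * θ) * Real.cos θ + Real.cos (n * θ) * Real.sin θ|
        ≤ |Real.sin (n * θ)| * |Real.cos θ| + |Real.cos (n * θ)| * |Real.sin θ| := by
          rw [← abs_mul, ← abs_mul]; exact abs_add_le _ _
      _ ≤ |Real.sin (n * θ)| * 1 + 1 * |Real.sin θ| := by
          gcongr <;> exact Real.abs_cos_le_one _
      _ ≤ (n + 1) * |Real.sin θ| := by linarith

/-- The bounds `|S| ≤ 2 k + 1` and `|S| ≤ 1 / t` in one: decay at scale `1 / (2 k + 1)`. -/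
theorem abs_eval_dirichletPoly_le (k : ℕ) {t : ℝ} (h0 : 0 < t) (h1 : t ≤ 1) :
    |(dirichletPoly k).eval (t ^ 2)| ≤ 2 * (2 * k + 1) / (1 + (2 * k + 1) * t) := by
  have hs : Real.sin (Real.arcsin t) = t := Real.sin_arcsin (by linarith) h1
  have h := sin_mul_eval_dirichletPoly (Real.arcsin t) k
  rw [hs] at h
  have ha : t * |(dirichletPoly k).eval (t ^ 2)| = |Real.sin ((2 * k + 1) * Real.arcsin t)| := by
    rw [← h, abs_mul, abs_of_pos h0]
  have hle1 : t * |(dirichletPoly k).eval (t ^ 2)| ≤ 1 := ha ▸ Real.abs_sin_le_one _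
  have hle2 : |(dirichletPoly k).eval (t ^ 2)| ≤ 2 * k + 1 := by
    have := abs_sin_nat_mul_le (Real.arcsin t) (2 * k + 1)
    push_cast at this
    rw [← ha, hs, abs_of_pos h0, mul_comm t] at this
    exact le_of_mul_le_mul_right this h0
  rw [le_div_iff₀ (by positivity)]
  nlinarith [mul_le_mul_of_nonneg_left hle1 (by positivity : (0 : ℝ) ≤ 2 * k + 1)]

theorem eval_zero_dirichletPoly : ∀ k : ℕ, (dirichletPoly k).eval 0 = 2 * k + 1
  | 0 => by simp [dirichletPoly]
  | 1 => by simp [dirichletPoly]; norm_num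
  | k + 2 => by
    simp [dirichletPoly, eval_zero_dirichletPoly (k + 1), eval_zero_dirichletPoly k]
    ring

theorem le_eval_dirichletPoly (k : ℕ) {t : ℝ} (ht : 0 ≤ t) (h1 : t ≤ 1 / (2 * k + 1)) :
    2 / Real.pi * (2 * k + 1) ≤ (dirichletPoly k).eval (t ^ 2) := by
  rcases ht.eq_or_lt with rfl | h0
  · rw [zero_pow two_ne_zero, eval_zero_dirichletPoly]
    refine mul_le_of_le_one_left (by positivity) ?_
    rw [div_le_one Real.pi_pos]
    exact Real.two_le_pi
  have hN : (0 : ℝ) < 2 * k + 1 := by positivity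
  have ht1 : t ≤ 1 := h1.trans (by rw [div_le_one hN]; linarith [(Nat.cast_nonneg k : (0 : ℝ) ≤ k)])
  have hs : Real.sin (Real.arcsin t) = t := Real.sin_arcsin (by linarith) ht1
  have h := sin_mul_eval_dirichletPoly (Real.arcsin t) k
  have hθ0 : 0 ≤ Real.arcsin t := Real.arcsin_nonneg.2 h0.le
  have hθt : t ≤ Real.arcsin t := by
    conv_lhs => rw [← hs]
    exact Real.sin_le hθ0
  have hj := Real.mul_le_sin hθ0 (Real.arcsin_le_pi_div_two t)
  rw [hs] at h hj
  have hpi := Real.pi_pos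
  have hNθ : (2 * k + 1) * Real.arcsin t ≤ Real.pi / 2 := by
    have h2 : Real.arcsin t ≤ Real.pi / 2 * t := by
      calc Real.arcsin t = Real.pi / 2 * (2 / Real.pi * Real.arcsin t) := by field_simp
        _ ≤ _ := by gcongr
    rw [le_div_iff₀ hN] at h1
    nlinarith
  have hl := Real.mul_le_sin (by positivity : 0 ≤ (2 * k + 1) * Real.arcsin t) hNθ
  rw [← h] at hl
  refine le_of_mul_le_mul_left (le_trans ?_ hl) h0
  have : 2 / Real.pi * (2 * k + 1) * t ≤ 2 / Real.pi * (2 * k + 1) * Real.arcsin t := by gcongr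
  linarith

/-- The (unnormalized) Jackson kernel on `ℝ^d` centred at `x₀`, as a polynomial in `y`:
`S_k (‖y - x₀‖² / (4 B²)) ^ (2 r)` with `S_k` the polynomial `dirichletPoly k`. It is used on the
ball of radius `2 B` around `x₀`, where the argument of `S_k` lies in `[0, 1]`. -/
noncomputable def jacksonKernel {d : ℕ} (x₀ : EuclideanSpace ℝ (Fin d)) (B : ℝ) (k r : ℕ) :
    MvPolynomial (Fin d) ℝ :=
  (Polynomial.aeval (MvPolynomial.C ((4 * B ^ 2)⁻¹) *
    ∑ i, (MvPolynomial.X i - MvPolynomial.C (x₀ i)) ^ 2) (dirichletPoly k)) ^ (2 * r)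

theorem eval_jacksonKernel {d : ℕ} (x₀ y : EuclideanSpace ℝ (Fin d)) (B : ℝ) (k r : ℕ) :
    MvPolynomial.eval y.ofLp (jacksonKernel x₀ B k r) =
      (dirichletPoly k).eval ((‖y - x₀‖ / (2 * B)) ^ 2) ^ (2 * r) := by
  rw [jacksonKernel, map_pow, ← MvPolynomial.coe_aeval_eq_eval, RingHom.coe_coe,
    ← Polynomial.aeval_algHom_apply, ← Polynomial.coe_aeval_eq_eval]
  congr 3
  simp only [map_mul, map_sum, map_pow, map_sub, MvPolynomial.aeval_X, MvPolynomial.aeval_C]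
  rw [div_pow, EuclideanSpace.norm_sq_eq]
  simp only [Real.norm_eq_abs, sq_abs, PiLp.sub_apply, Algebra.algebraMap_self, RingHom.id_apply]
  rw [mul_pow, div_eq_inv_mul]
  norm_num

theorem totalDegree_jacksonKernel_le {d : ℕ} (x₀ : EuclideanSpace ℝ (Fin d)) (B : ℝ) (k r : ℕ) :
    (jacksonKernel x₀ B k r).totalDegree ≤ 4 * r * k := by
  rw [jacksonKernel]
  refine (MvPolynomial.totalDegree_pow _ _).trans ?_
  have hbase : (MvPolynomial.C ((4 * B ^ 2)⁻¹) *
      ∑ i, (MvPolynomial.X i - MvPolynomial.C (x₀ i)) ^ 2 : MvPolynomial (Fin d) ℝ).totalDegree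
      ≤ 2 := by
    refine (MvPolynomial.totalDegree_mul _ _).trans ?_
    rw [MvPolynomial.totalDegree_C, zero_add]
    refine MvPolynomial.totalDegree_finsetSum_le fun i _ => ?_
    refine (MvPolynomial.totalDegree_pow _ _).trans ?_
    have := MvPolynomial.totalDegree_sub_C_le (MvPolynomial.X i) (x₀ i)
    rw [MvPolynomial.totalDegree_X] at this
    omega
  have h : (Polynomial.aeval (MvPolynomial.C ((4 * B ^ 2)⁻¹) *
      ∑ i, (MvPolynomial.X i - MvPolynomial.C (x₀ i)) ^ 2 : MvPolynomial (Fin d) ℝ)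
      (dirichletPoly k)).totalDegree ≤ k * 2 := by
    rw [Polynomial.aeval_eq_sum_range]
    refine MvPolynomial.totalDegree_finsetSum_le fun i hi => ?_
    refine (MvPolynomial.totalDegree_smul_le _ _).trans ?_
    refine (MvPolynomial.totalDegree_pow _ _).trans (Nat.mul_le_mul ?_ hbase)
    exact (Nat.lt_succ_iff.1 (Finset.mem_range.1 hi)).trans (natDegree_dirichletPoly_le k)
  calc 2 * r * _ ≤ 2 * r * (k * 2) := Nat.mul_le_mul_left _ h
    _ = 4 * r * k := by ring

section Kernel

variable {d : ℕ} (x₀ : EuclideanSpace ℝ (Fin d)) {B : ℝ} (k : ℕ)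

theorem continuous_eval_jacksonKernel (B : ℝ) (r : ℕ) :
    Continuous fun y : EuclideanSpace ℝ (Fin d) =>
      MvPolynomial.eval y.ofLp (jacksonKernel x₀ B k r) :=
  (MvPolynomial.continuous_eval _).comp (by fun_prop)

theorem eval_jacksonKernel_nonneg (B : ℝ) (r : ℕ) (y : EuclideanSpace ℝ (Fin d)) :
    0 ≤ MvPolynomial.eval y.ofLp (jacksonKernel x₀ B k r) := by
  rw [eval_jacksonKernel, pow_mul]
  positivity

theorem integrable_inv_one_add_norm_pow {s : ℕ} (hs : d < s) :
    Integrable fun z : EuclideanSpace ℝ (Fin d) => ((1 + ‖z‖) ^ s)⁻¹ := by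
  have h := integrable_one_add_norm (E := EuclideanSpace ℝ (Fin d)) (μ := volume) (r := (s : ℝ))
    (by simpa using hs)
  refine h.congr (Filter.Eventually.of_forall fun z => ?_)
  simp only
  rw [Real.rpow_neg (by positivity), Real.rpow_natCast]

theorem norm_mul_eval_jacksonKernel_le (hB : 0 < B) (s : ℕ) {y : EuclideanSpace ℝ (Fin d)}
    (hy : y ∈ Metric.closedBall x₀ (2 * B)) :
    ‖y - x₀‖ * MvPolynomial.eval y.ofLp (jacksonKernel x₀ B k (s + 1)) ≤
      2 * B / (2 * k + 1) * (2 * (2 * k + 1)) ^ (2 * s + 2) *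
        ((1 + ‖((2 * k + 1) / (2 * B)) • (y - x₀)‖) ^ (2 * s + 1))⁻¹ := by
  rcases eq_or_ne y x₀ with rfl | hne
  · simp only [sub_self, norm_zero, zero_mul]
    positivity
  have hN : (0 : ℝ) < 2 * k + 1 := by positivity
  have hpos : 0 < ‖y - x₀‖ := norm_pos_iff.2 (sub_ne_zero.2 hne)
  obtain ⟨t, ht⟩ : ∃ t, t = ‖y - x₀‖ / (2 * B) := ⟨_, rfl⟩
  have ht0 : 0 < t := ht ▸ by positivity
  have ht1 : t ≤ 1 := by
    rw [ht, div_le_one (by positivity), ← dist_eq_norm]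
    exact hy
  have hnorm : ‖y - x₀‖ = 2 * B / (2 * k + 1) * ((2 * k + 1) * t) := by
    rw [ht]; field_simp
  have hsmul : ‖((2 * k + 1) / (2 * B)) • (y - x₀)‖ = (2 * k + 1) * t := by
    rw [norm_smul, Real.norm_of_nonneg (by positivity), ht]; ring
  rw [hsmul, eval_jacksonKernel, ← ht]
  have hQ : (dirichletPoly k).eval (t ^ 2) ^ (2 * (s + 1)) ≤
      (2 * (2 * k + 1) / (1 + (2 * k + 1) * t)) ^ (2 * s + 2) := by
    rw [← Even.pow_abs (even_two_mul _)]
    exact pow_le_pow_left₀ (abs_nonneg _) (abs_eval_dirichletPoly_le k ht0 ht1) _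
  calc ‖y - x₀‖ * (dirichletPoly k).eval (t ^ 2) ^ (2 * (s + 1))
      ≤ 2 * B / (2 * k + 1) * (1 + (2 * k + 1) * t) *
        (2 * (2 * k + 1) / (1 + (2 * k + 1) * t)) ^ (2 * s + 2) := by
        rw [hnorm]
        have h2 : (0 : ℝ) ≤ (dirichletPoly k).eval (t ^ 2) ^ (2 * (s + 1)) := by
          rw [pow_mul]; positivity
        gcongr
        linarith
    _ = _ := by
        have : (1 + (2 * k + 1) * t) ≠ 0 := by positivity
        rw [div_pow]
        field_simp
        ring

/-- The first absolute moment of the Jackson kernel about its centre, bounded by rescaling to the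
integrable profile `(1 + ‖z‖) ^ (-(2 d + 1))`. -/
theorem integral_norm_mul_jacksonKernel_le (hB : 0 < B) :
    ∫ y in Metric.closedBall x₀ (2 * B),
        ‖y - x₀‖ * MvPolynomial.eval y.ofLp (jacksonKernel x₀ B k (d + 1)) ≤
      2 * B / (2 * k + 1) * (2 * (2 * k + 1)) ^ (2 * d + 2) * ((2 * B / (2 * k + 1)) ^ d *
        ∫ z : EuclideanSpace ℝ (Fin d), ((1 + ‖z‖) ^ (2 * d + 1))⁻¹) := by
  have hI := integrable_inv_one_add_norm_pow (d := d) (s := 2 * d + 1) (by omega)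
  have hc : (0 : ℝ) < (2 * k + 1) / (2 * B) := by positivity
  have hH : Integrable fun y : EuclideanSpace ℝ (Fin d) =>
      ((1 + ‖((2 * k + 1) / (2 * B)) • (y - x₀)‖) ^ (2 * d + 1))⁻¹ :=
    (hI.comp_smul hc.ne').comp_sub_right x₀
  have hval : ∫ y : EuclideanSpace ℝ (Fin d),
      ((1 + ‖((2 * k + 1) / (2 * B)) • (y - x₀)‖) ^ (2 * d + 1))⁻¹ =
      (2 * B / (2 * k + 1)) ^ d *
        ∫ z : EuclideanSpace ℝ (Fin d), ((1 + ‖z‖) ^ (2 * d + 1))⁻¹ := by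
    rw [integral_sub_right_eq_self (fun y : EuclideanSpace ℝ (Fin d) =>
        ((1 + ‖((2 * k + 1) / (2 * B)) • y‖) ^ (2 * d + 1))⁻¹) x₀,
      Measure.integral_comp_smul volume (fun y : EuclideanSpace ℝ (Fin d) =>
        ((1 + ‖y‖) ^ (2 * d + 1))⁻¹), finrank_euclideanSpace_fin, abs_of_pos (by positivity),
      ← inv_pow, inv_div, smul_eq_mul]
  rw [← hval, ← integral_const_mul]
  refine (setIntegral_mono_on ?_ (hH.const_mul _).integrableOn measurableSet_closedBall
    fun y hy => norm_mul_eval_jacksonKernel_le x₀ k hB d hy).trans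
    (setIntegral_le_integral (hH.const_mul _) (Filter.Eventually.of_forall fun y => by positivity))
  have hcont := continuous_eval_jacksonKernel x₀ k B (d + 1)
  exact ContinuousOn.integrableOn_compact (isCompact_closedBall _ _) (by fun_prop)

/-- A lower bound for the mass of the Jackson kernel, which the ball of radius `2 B / (2 k + 1)`
around the centre already provides. -/
theorem le_integral_jacksonKernel (hB : 0 < B) (r : ℕ) :
    (2 / Real.pi * (2 * k + 1)) ^ (2 * r) * ((2 * B / (2 * k + 1)) ^ d *
        volume.real (Metric.ball (0 : EuclideanSpace ℝ (Fin d)) 1)) ≤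
      ∫ y in Metric.closedBall x₀ (2 * B),
        MvPolynomial.eval y.ofLp (jacksonKernel x₀ B k r) := by
  have hcont := continuous_eval_jacksonKernel x₀ k B r
  have hint : IntegrableOn (fun y : EuclideanSpace ℝ (Fin d) =>
      MvPolynomial.eval y.ofLp (jacksonKernel x₀ B k r)) (Metric.closedBall x₀ (2 * B)) :=
    hcont.continuousOn.integrableOn_compact (isCompact_closedBall _ _)
  have hN : (1 : ℝ) ≤ 2 * k + 1 := by linarith [(Nat.cast_nonneg k : (0 : ℝ) ≤ k)]
  have hsub : Metric.closedBall x₀ (2 * B / (2 * k + 1)) ⊆ Metric.closedBall x₀ (2 * B) :=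
    Metric.closedBall_subset_closedBall (div_le_self (by positivity) hN)
  have hvol := Measure.addHaar_real_closedBall (volume : Measure (EuclideanSpace ℝ (Fin d))) x₀
    (by positivity : 0 ≤ 2 * B / (2 * k + 1))
  rw [finrank_euclideanSpace_fin] at hvol
  rw [← hvol, mul_comm, ← smul_eq_mul, ← setIntegral_const]
  refine le_trans (setIntegral_mono_on ?_ (hint.mono_set hsub) measurableSet_closedBall
    fun y hy => ?_) (setIntegral_mono_set hint
      (Filter.Eventually.of_forall fun y => eval_jacksonKernel_nonneg x₀ k B r y)
      hsub.eventuallyLE)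
  · exact integrableOn_const (measure_closedBall_lt_top.ne)
  · rw [eval_jacksonKernel]
    refine pow_le_pow_left₀ (by positivity) (le_eval_dirichletPoly k (by positivity) ?_) _
    rw [Metric.mem_closedBall, dist_eq_norm] at hy
    rw [div_le_iff₀ (by positivity)]
    exact hy.trans (le_of_eq (by ring))

end Kernel

/-! ### The bound for the residual -/

/-- The ratio, up to the factor `(2 * k + 1) / B`, between the bounds for the first absolute moment
and for the mass of the Jackson kernel. -/
noncomputable def jacksonConst (d : ℕ) : ℝ :=
  2 * Real.pi ^ (2 * d + 2) * (∫ z : EuclideanSpace ℝ (Fin d), ((1 + ‖z‖) ^ (2 * d + 1))⁻¹) /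
    volume.real (Metric.ball (0 : EuclideanSpace ℝ (Fin d)) 1)

theorem jacksonConst_nonneg (d : ℕ) : 0 ≤ jacksonConst d := by
  have : 0 ≤ ∫ z : EuclideanSpace ℝ (Fin d), ((1 + ‖z‖) ^ (2 * d + 1))⁻¹ :=
    integral_nonneg fun z => by positivity
  unfold jacksonConst
  positivity

/-- Since `p - q` is orthogonal to the Jackson kernel centred at `x`, the value of `p - q` at `x`
is a kernel average of the differences `(p - q) x - (p - q) y`. -/
theorem abs_sub_le_of_determinesForms {d m K k : ℕ} {W : Fin K → Matrix (Fin d) (Fin m) ℝ}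
    {p q : EuclideanSpace ℝ (Fin d) → ℝ} {x₀ : EuclideanSpace ℝ (Fin d)} {B : ℝ} {L : ℝ≥0}
    (hW : DeterminesForms W (4 * (d + 1) * k)) (hB : 0 < B) (hp : IsDensity p) (hq : IsDensity q)
    (hsp : Function.support p ⊆ Metric.closedBall x₀ B)
    (hsq : Function.support q ⊆ Metric.closedBall x₀ B)
    (hmarg : ∀ k, marginal (W k) p = marginal (W k) q)
    (hL : LipschitzWith L (fun x => p x - q x)) (x : EuclideanSpace ℝ (Fin d)) :
    |p x - q x| ≤ jacksonConst d * (B * L / (2 * k + 1)) := by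
  have hzero : ∀ y, y ∉ Metric.closedBall x₀ B → p y - q y = 0 := by
    intro y hy
    rw [Function.notMem_support.1 fun h => hy (hsp h),
      Function.notMem_support.1 fun h => hy (hsq h), sub_zero]
  by_cases hx : x ∈ Metric.closedBall x₀ B
  swap
  · rw [hzero x hx, abs_zero]
    have := jacksonConst_nonneg d
    positivity
  let Q : EuclideanSpace ℝ (Fin d) → ℝ := fun y =>
    MvPolynomial.eval y.ofLp (jacksonKernel x B k (d + 1))
  have hQc : Continuous Q := continuous_eval_jacksonKernel x k B (d + 1)
  have hQ0 : ∀ y, 0 ≤ Q y := eval_jacksonKernel_nonneg x k B (d + 1)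
  have hRc : Continuous fun y => p y - q y := hL.continuous
  have hionc : ∀ g : EuclideanSpace ℝ (Fin d) → ℝ, Continuous g →
      IntegrableOn g (Metric.closedBall x (2 * B)) := fun g hg =>
    hg.continuousOn.integrableOn_compact (isCompact_closedBall _ _)
  have horth : ∫ y in Metric.closedBall x (2 * B), Q y * (p y - q y) = 0 := by
    rw [setIntegral_eq_integral_of_forall_compl_eq_zero]
    · exact integral_eval_mul_eq_zero hW hp hq hsp hsq hmarg _
        (totalDegree_jacksonKernel_le x B k (d + 1))
    -- The support lies in the ball of radius `B` around `x₀`, hence in the one of radius `2 B`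
    -- around `x`, on which the kernel is controlled.
    · intro y hy
      rw [hzero y fun h => hy ?_, mul_zero]
      rw [Metric.mem_closedBall] at h hx ⊢
      linarith [dist_triangle_right y x x₀]
  have hkey : |p x - q x| * ∫ y in Metric.closedBall x (2 * B), Q y ≤
      L * ∫ y in Metric.closedBall x (2 * B), ‖y - x‖ * Q y := by
    have h1 : (p x - q x) * ∫ y in Metric.closedBall x (2 * B), Q y =
        ∫ y in Metric.closedBall x (2 * B), ((p x - q x) - (p y - q y)) * Q y := by
      rw [← integral_const_mul, ← sub_zero (∫ y in _, (p x - q x) * Q y), ← horth,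
        ← integral_sub (hionc (fun y => (p x - q x) * Q y)
          (continuous_const.mul hQc)) (hionc (fun y => Q y * (p y - q y))
          (hQc.mul hRc))]
      refine integral_congr_ae (Filter.Eventually.of_forall fun y => ?_)
      simp only
      ring
    have hA : 0 ≤ ∫ y in Metric.closedBall x (2 * B), Q y := integral_nonneg hQ0
    rw [← abs_of_nonneg hA, ← abs_mul, h1, ← integral_const_mul]
    refine (abs_integral_le_integral_abs).trans ?_
    refine setIntegral_mono_on (hionc _ ?_) (hionc _ (by fun_prop)) measurableSet_closedBall
      fun y _ => ?_
    · exact ((continuous_const.sub hRc).mul hQc).abs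
    · rw [abs_mul, abs_of_nonneg (hQ0 y), ← mul_assoc]
      refine mul_le_mul_of_nonneg_right ?_ (hQ0 y)
      have := hL.dist_le_mul x y
      rwa [Real.dist_eq, dist_comm, dist_eq_norm] at this
  have hJ := integral_norm_mul_jacksonKernel_le x k hB
  have hA := le_integral_jacksonKernel x k hB (d + 1)
  have hω : 0 < volume.real (Metric.ball (0 : EuclideanSpace ℝ (Fin d)) 1) :=
    ENNReal.toReal_pos (Metric.measure_ball_pos _ _ one_pos).ne' measure_ball_lt_top.ne
  have hpi := Real.pi_pos
  have h2 := (mul_le_mul_of_nonneg_left hA (abs_nonneg (p x - q x))).trans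
    (hkey.trans (mul_le_mul_of_nonneg_left hJ L.2))
  have hpos : 0 < (2 / Real.pi * (2 * k + 1)) ^ (2 * (d + 1)) * ((2 * B / (2 * k + 1)) ^ d *
      volume.real (Metric.ball (0 : EuclideanSpace ℝ (Fin d)) 1)) := by positivity
  rw [← le_div_iff₀ hpos] at h2
  refine h2.trans (le_of_eq ?_)
  have e : 2 * (d + 1) = 2 * d + 2 := by ring
  rw [jacksonConst, e]
  simp only [mul_pow, div_pow]
  field_simp

theorem residualBound_of_determinesForms {d m K k : ℕ}
    {W : Fin K → Matrix (Fin d) (Fin m) ℝ} (hK0 : 1 ≤ K)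
    (hW : DeterminesForms W (4 * (d + 1) * k))
    (hK : (K : ℝ) ^ ((1 : ℝ) / ((d : ℝ) - (m : ℝ))) ≤ 8 * (d + 1) * (2 * k + 1)) :
    ResidualBound W (jacksonConst d * (8 * (d + 1)) + 1) := by
  intro p q x₀ B L hB hp hq hsp hsq hmarg hL x
  refine (abs_sub_le_of_determinesForms hW hB hp hq hsp hsq hmarg hL x).trans ?_
  have hC := jacksonConst_nonneg d
  have hKpos : 0 < (K : ℝ) ^ ((1 : ℝ) / ((d : ℝ) - (m : ℝ))) :=
    Real.rpow_pos_of_pos (by exact_mod_cast hK0) _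
  have hBL : 0 ≤ B * (L : ℝ) := by positivity
  calc jacksonConst d * (B * L / (2 * k + 1))
      = jacksonConst d * (8 * (d + 1)) * (B * L / (8 * (d + 1) * (2 * k + 1))) := by field_simp
    _ ≤ jacksonConst d * (8 * (d + 1)) *
        (B * L / (K : ℝ) ^ ((1 : ℝ) / ((d : ℝ) - (m : ℝ)))) := by gcongr
    _ ≤ _ := by
        refine mul_le_mul_of_nonneg_right (by linarith) (by positivity)

/-- A degree parameter `k` that `K` subspaces can afford, and that is of order
`K ^ (1 / (d - m))`. -/
theorem exists_degree {d m K : ℕ} (hmd : m < d) (hK : 1 ≤ K) :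
    ∃ k : ℕ, (4 * (d + 1) * k + 1) ^ (d - m) ≤ K ∧
      (K : ℝ) ^ ((1 : ℝ) / ((d : ℝ) - (m : ℝ))) ≤ 8 * (d + 1) * (2 * k + 1) := by
  have hKR : (1 : ℝ) ≤ K := by exact_mod_cast hK
  have hsub : ((d : ℝ) - (m : ℝ)) = ((d - m : ℕ) : ℝ) := by
    rw [Nat.cast_sub hmd.le]
  have hdm : d - m ≠ 0 := by omega
  rw [hsub]
  set y : ℝ := (K : ℝ) ^ ((1 : ℝ) / ((d - m : ℕ) : ℝ)) with hy
  have hy1 : 1 ≤ y := Real.one_le_rpow hKR (by positivity)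
  have hyK : y ^ (d - m) = K := by
    rw [hy, one_div, Real.rpow_inv_natCast_pow (by positivity) hdm]
  have hM1 : 1 ≤ ⌊y⌋₊ := Nat.le_floor (by simpa using hy1)
  refine ⟨(⌊y⌋₊ - 1) / (4 * (d + 1)), ?_, ?_⟩
  · have h1 : 4 * (d + 1) * ((⌊y⌋₊ - 1) / (4 * (d + 1))) + 1 ≤ ⌊y⌋₊ := by
      have := Nat.mul_div_le (⌊y⌋₊ - 1) (4 * (d + 1))
      omega
    have h2 : ((⌊y⌋₊ : ℕ) : ℝ) ^ (d - m) ≤ K := by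
      rw [← hyK]
      exact pow_le_pow_left₀ (by positivity) (Nat.floor_le (by linarith)) _
    exact (Nat.pow_le_pow_left h1 _).trans (by exact_mod_cast h2)
  · have h1 : ⌊y⌋₊ - 1 < 4 * (d + 1) * ((⌊y⌋₊ - 1) / (4 * (d + 1)) + 1) := by
      rw [mul_comm]
      exact Nat.lt_mul_of_div_lt (Nat.lt_succ_self _) (by positivity)
    have h2 : ⌊y⌋₊ ≤ 4 * (d + 1) * ((⌊y⌋₊ - 1) / (4 * (d + 1)) + 1) := by omega
    have h3 : ((⌊y⌋₊ : ℕ) : ℝ) ≤ 4 * (d + 1) * (((⌊y⌋₊ - 1) / (4 * (d + 1)) : ℕ) + 1) := by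
      exact_mod_cast h2
    have h4 := Nat.lt_floor_add_one y
    have h5 : (0 : ℝ) ≤ (d + 1) * (((⌊y⌋₊ - 1) / (4 * (d + 1)) : ℕ) : ℝ) := by positivity
    have h6 : (0 : ℝ) ≤ d := Nat.cast_nonneg d
    linarith

end RandomProjections

theorem theorem3 (d m : ℕ) (hm : 1 ≤ m) (hmd : m < d) :
    ∃ a : ℝ, 0 < a ∧ ∀ δ : ℝ, 0 < δ → ∃ C : ℝ, 0 < C ∧
      ∀ (K : ℕ), 1 ≤ K →
        ∀ (Ω : Type*) [MeasurableSpace Ω] (P : Measure Ω) [IsProbabilityMeasure P]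
          (v : ℝ≥0) (W : Fin K → Ω → Matrix (Fin d) (Fin m) ℝ),
          v ≠ 0 → RandomProjections.IsGaussianProjections P v W →
          P {ω | ¬ RandomProjections.ResidualBound (fun k => W k ω) C}
            ≤ ENNReal.ofReal (δ * Real.exp (-(a * (K : ℝ)))) := by
  have hC := RandomProjections.jacksonConst_nonneg d
  refine ⟨1, one_pos, fun δ _ => ⟨RandomProjections.jacksonConst d * (8 * (d + 1)) + 1,
    by positivity, ?_⟩⟩
  intro K hK Ω _ P _ v W hv hW
  obtain ⟨k, hkK, hk⟩ := RandomProjections.exists_degree hmd hK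
  have hae : ∀ᵐ ω ∂P, RandomProjections.ResidualBound (fun k => W k ω)
      (RandomProjections.jacksonConst d * (8 * (d + 1)) + 1) := by
    filter_upwards [hW.ae_determinesForms hv hm hmd hkK] with ω hω
    exact RandomProjections.residualBound_of_determinesForms hK hω hk
  rw [ae_iff.1 hae]
  exact zero_le
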